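/- Let $\Omega\subset\mathbb R^2$ be a bounded convex domain (i.e. a bounded convex open set). Then there is a constant $C>0$, depending only on $\Omega$, such that for every $v\in H^1(\Omega)$, every measurable set $D\subset\Omega$ and every $0<\varepsilon<1$, $$\iint_D v^2\,dp\;\le\;\frac{C}{\varepsilon}\,|D|^{1-\varepsilon}\,\|v\|_{1,\Omega}^2,$$ where $|D|$ is the Lebesgue measure of $D$ and $\|v\|_{1,\Omega}=\bigl(\iint_\Omega (v^2+|\partial_x v|^2+|\partial_y v|^2)\,dp\bigr)^{1/2}$ is the norm of $H^1(\Omega)$, with $\partial_x v,\partial_y v\in L^2(\Omega)$ the weak partial derivatives. -/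

import Mathlib

open MeasureTheory
open scoped ContDiff

namespace PlanarSobolev

/-- The Euclidean plane, with the Euclidean norm and Lebesgue measure. -/
abbrev Plane : Type := EuclideanSpace ℝ (Fin 2)

/-- The classical partial derivative `∂ᵢ φ` at the point `x`. -/
noncomputable def partialDeriv (i : Fin 2) (φ : Plane → ℝ) (x : Plane) : ℝ :=
  fderiv ℝ φ x (EuclideanSpace.single i 1)

/-- Test functions on `Ω`: smooth functions with compact support contained in `Ω`. -/
def IsTestFunction (Ω : Set Plane) (φ : Plane → ℝ) : Prop :=
  ContDiff ℝ ∞ φ ∧ HasCompactSupport φ ∧ tsupport φ ⊆ Ω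

/-- `w` is an `L²(Ω)` weak partial derivative of `v` on `Ω` in the `i`-th coordinate direction:
`w ∈ L²(Ω)` and `∬_Ω v ∂ᵢφ = - ∬_Ω w φ` for every test function `φ` on `Ω`. -/
def IsWeakPartial (Ω : Set Plane) (i : Fin 2) (v w : Plane → ℝ) : Prop :=
  MemLp w 2 (volume.restrict Ω) ∧
    ∀ φ : Plane → ℝ, IsTestFunction Ω φ →
      ∫ x in Ω, v x * partialDeriv i φ x = -∫ x in Ω, w x * φ x

/-- `v ∈ H¹(Ω)`: `v` is in `L²(Ω)` and has both weak partial derivatives, in `L²(Ω)`. -/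
def MemH1 (Ω : Set Plane) (v : Plane → ℝ) : Prop :=
  MemLp v 2 (volume.restrict Ω) ∧ ∀ i : Fin 2, ∃ w : Plane → ℝ, IsWeakPartial Ω i v w

open Classical in
/-- The weak partial derivative of `v` (a representative; it is unique almost everywhere on an open
set `Ω`, see `IsWeakPartial.ae_eq`; the value `0` is used only if there is none). -/
noncomputable def weakPartial (Ω : Set Plane) (i : Fin 2) (v : Plane → ℝ) : Plane → ℝ :=
  if h : ∃ w : Plane → ℝ, IsWeakPartial Ω i v w then h.choose else 0

/-- The norm `‖v‖_{1,Ω} = (∬_Ω (v² + |∂₁v|² + |∂₂v|²))^{1/2}` of `H¹(Ω)`. -/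
noncomputable def h1Norm (Ω : Set Plane) (v : Plane → ℝ) : ℝ :=
  Real.sqrt (∫ x in Ω, (v x ^ 2 + ∑ i : Fin 2, weakPartial Ω i v x ^ 2))

theorem IsWeakPartial.ae_eq {Ω : Set Plane} (hΩ : IsOpen Ω) {i : Fin 2} {v w₁ w₂ : Plane → ℝ}
    (h₁ : IsWeakPartial Ω i v w₁) (h₂ : IsWeakPartial Ω i v w₂) :
    w₁ =ᵐ[volume.restrict Ω] w₂ := by
  have hl : ∀ w : Plane → ℝ, MemLp w 2 (volume.restrict Ω) → LocallyIntegrable w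
      (volume.restrict Ω) := fun w hw => hw.locallyIntegrable (by norm_num)
  have hz : ∀ᵐ x ∂(volume : Measure Plane), x ∈ Ω → (w₁ - w₂) x = 0 := by
    refine hΩ.ae_eq_zero_of_integral_contDiff_smul_eq_zero ?_ ?_
    · exact (locallyIntegrableOn_of_locallyIntegrable_restrict (hl _ h₁.1)).sub
        (locallyIntegrableOn_of_locallyIntegrable_restrict (hl _ h₂.1))
    · intro g hg hc hs
      have e₁ := h₁.2 g ⟨hg, hc, hs⟩
      have e₂ := h₂.2 g ⟨hg, hc, hs⟩
      have i₁ : Integrable (fun x => g x * w₁ x) (volume.restrict Ω) :=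
        (hl _ h₁.1).integrable_smul_left_of_hasCompactSupport hg.continuous hc
      have i₂ : Integrable (fun x => g x * w₂ x) (volume.restrict Ω) :=
        (hl _ h₂.1).integrable_smul_left_of_hasCompactSupport hg.continuous hc
      have hr : ∫ x, g x • (w₁ - w₂) x = ∫ x in Ω, g x • (w₁ - w₂) x := by
        refine (setIntegral_eq_integral_of_forall_compl_eq_zero fun x hx => ?_).symm
        rw [image_eq_zero_of_notMem_tsupport fun h => hx (hs h), zero_smul]
      rw [hr]
      have : ∀ x, g x • (w₁ - w₂) x = g x * w₁ x - g x * w₂ x := fun x => by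
        simp [mul_sub]
      simp only [this]
      rw [integral_sub i₁ i₂]
      simp only [mul_comm (g _)]
      linarith
  refine (ae_restrict_iff' hΩ.measurableSet).2 ?_
  filter_upwards [hz] with x hx hxΩ
  exact sub_eq_zero.1 (hx hxΩ)

end PlanarSobolev

open Set Filter Topology ENNReal
open scoped Convolution

/-! The proof represents `v` by a Riesz potential of its gradient and never uses an Lᵖ Sobolev
embedding. Let `B ⊂ Ω` be a fixed ball, `d` larger than all distances in `Ω`, and `k(h) = 1/‖h‖` for
`‖h‖ < d`, zero otherwise. For smooth `u`, integrating `u(x) - u(y)` along the segment from `x` to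
`y`, which convexity keeps in the domain, and then over `y ∈ B` gives |B| |u(x)| ≤ ∫_B |u| + (d²/2)
∫ |∇u(z)| k(z - x) dz (`measure_mul_enorm_le`).

The potential is estimated in L²(D) by splitting `k = k^(1-ε/2) · k^(ε/2)` in Cauchy–Schwarz
(`lintegral_sq_rieszPotential_le`). The first factor contributes ∫ k^(2-ε) = 2π d^ε / ε, the source
of 1/ε. The second, after Tonelli, contributes ∫_D k(z - x)^ε dx, which Hölder bounds by |D|^(1-ε)
(∫ k)^ε.

A general `v` is extended by zero and mollified. At points far enough inside `Ω` the gradient of the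
mollification is the mollified weak gradient (`enorm_fderiv_mollify_single_le`), and mollification
does not increase L² norms. The bounds are therefore uniform in the scale, and Fatou's lemma
transfers them to `v` (`sq_mul_lintegral_le_of_ae_tendsto`). -/

namespace PlanarSobolev

/-! ### The truncated Riesz kernel and its potential in L²(D) -/

/-- The truncated Riesz kernel `h ↦ 1 / ‖h‖` on the ball of radius `d`. -/
noncomputable def rieszKernel (d : ℝ) (h : Plane) : ℝ≥0∞ :=
  (Metric.ball (0 : Plane) d).indicator (fun h => ENNReal.ofReal ‖h‖⁻¹) h

theorem measurable_rieszKernel (d : ℝ) : Measurable (rieszKernel d) :=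
  (by fun_prop : Measurable fun h : Plane => ENNReal.ofReal ‖h‖⁻¹).indicator measurableSet_ball

theorem rieszKernel_rpow {d s : ℝ} (hs : 0 < s) (h : Plane) :
    rieszKernel d h ^ s = ENNReal.ofReal ((Iio d).indicator (fun r => r ^ (-s)) ‖h‖) := by
  unfold rieszKernel
  by_cases hh : ‖h‖ < d
  · rw [indicator_of_mem (by simpa using hh), indicator_of_mem (by simpa using hh),
      ENNReal.ofReal_rpow_of_nonneg (by positivity) hs.le, Real.rpow_neg (norm_nonneg _),
      Real.inv_rpow (norm_nonneg _)]
  · rw [indicator_of_notMem (by simpa using hh), indicator_of_notMem (by simpa using hh)]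
    simp [hs]

/-- In polar coordinates the integrand is `r^(1-s)`, integrable at the origin exactly when `s < 2`.
The factor `1 / (2 - s)` becomes `1 / ε` at the exponent `2 - ε`. -/
theorem lintegral_rieszKernel_rpow {d s : ℝ} (hd : 0 < d) (hs : 0 < s) (hs2 : s < 2) :
    ∫⁻ h, rieszKernel d h ^ s = ENNReal.ofReal (2 * Real.pi * d ^ (2 - s) / (2 - s)) := by
  simp only [rieszKernel_rpow hs]
  have hrad : (fun y : ℝ => y ^ (2 - 1) • (Iio d).indicator (fun r => r ^ (-s)) y) =
      (Iio d).indicator fun y => y * y ^ (-s) := by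
    ext y
    by_cases hy : y ∈ Iio d <;> simp [hy]
  have hpow : EqOn (fun y : ℝ => y * y ^ (-s)) (fun y => y ^ (1 - s)) (Ioo 0 d) := by
    intro y hy
    simp only
    rw [sub_eq_add_neg, Real.rpow_add hy.1, Real.rpow_one]
  have hint : IntegrableOn (fun y : ℝ => y ^ (1 - s)) (Ioo 0 d) :=
    (intervalIntegral.integrableOn_Ioo_rpow_iff hd).2 (by linarith)
  rw [← ofReal_integral_eq_lintegral_ofReal]
  · rw [integral_fun_norm_addHaar]
    simp only [finrank_euclideanSpace, Fintype.card_fin]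
    rw [hrad, setIntegral_indicator measurableSet_Iio, Ioi_inter_Iio,
      setIntegral_congr_fun measurableSet_Ioo hpow, ← integral_Ioc_eq_integral_Ioo,
      ← intervalIntegral.integral_of_le hd.le, integral_rpow (Or.inl (by linarith))]
    rw [Real.zero_rpow (by linarith), Measure.real, EuclideanSpace.volume_ball_fin_two]
    congr 1
    have : (1 - s + 1) = 2 - s := by ring
    simp [this, Real.pi_pos.le]
    ring
  · rw [integrable_fun_norm_addHaar]
    simp only [finrank_euclideanSpace, Fintype.card_fin]
    rw [hrad, integrableOn_indicator_iff measurableSet_Iio, inter_comm, Ioi_inter_Iio]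
    exact hint.congr_fun hpow.symm measurableSet_Ioo
  · refine Eventually.of_forall fun h => ?_
    simp only [Pi.zero_apply, indicator_apply]
    split_ifs <;> positivity

theorem sq_lintegral_mul_le {α : Type*} [MeasurableSpace α] {μ : Measure α} {f g : α → ℝ≥0∞}
    (hf : AEMeasurable f μ) (hg : AEMeasurable g μ) :
    (∫⁻ a, f a * g a ∂μ) ^ 2 ≤ (∫⁻ a, f a ^ 2 ∂μ) * ∫⁻ a, g a ^ 2 ∂μ := by
  have h := ENNReal.lintegral_mul_le_Lp_mul_Lq μ Real.HolderConjugate.two_two hf hg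
  simp only [ENNReal.rpow_two, Pi.mul_apply] at h
  refine (pow_le_pow_left' h 2).trans_eq ?_
  rw [mul_pow, ← ENNReal.rpow_mul_natCast, ← ENNReal.rpow_mul_natCast]
  simp

/-- Cauchy–Schwarz for the factors `k^(1 - s/2)` and `g k^(s/2)`. For small `s` almost all of the
singularity sits in the first integral. -/
theorem sq_lintegral_mul_kernel_le {α : Type*} [MeasurableSpace α] {μ : Measure α}
    {g k : α → ℝ≥0∞} (hg : AEMeasurable g μ) (hk : AEMeasurable k μ) {s : ℝ} (hs0 : 0 ≤ s)
    (hs2 : s ≤ 2) :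
    (∫⁻ a, g a * k a ∂μ) ^ 2 ≤ (∫⁻ a, k a ^ (2 - s) ∂μ) * ∫⁻ a, g a ^ 2 * k a ^ s ∂μ := by
  have h := sq_lintegral_mul_le (μ := μ) (hk.pow_const (1 - s / 2)) (hg.mul (hk.pow_const (s / 2)))
  have h1 : ∀ a, k a ^ (1 - s / 2) * (g a * k a ^ (s / 2)) = g a * k a := fun a => by
    rw [mul_left_comm, ← ENNReal.rpow_add_of_nonneg _ _ (by linarith) (by linarith)]
    simp
  have h2 : ∀ a, (k a ^ (1 - s / 2)) ^ 2 = k a ^ (2 - s) := fun a => by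
    rw [← ENNReal.rpow_mul_natCast]; congr 1; push_cast; ring
  have h3 : ∀ a, (g a * k a ^ (s / 2)) ^ 2 = g a ^ 2 * k a ^ s := fun a => by
    rw [mul_pow, ← ENNReal.rpow_mul_natCast]; congr 2; push_cast; ring
  simpa only [Pi.mul_apply, h1, h2, h3] using h

/-- Hölder against the constant 1, with exponents `1/s` and `1/(1-s)`. -/
theorem lintegral_rpow_le_of_lt_one {α : Type*} [MeasurableSpace α] {μ : Measure α}
    {f : α → ℝ≥0∞} (hf : AEMeasurable f μ) {s : ℝ} (hs0 : 0 < s) (hs1 : s < 1) :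
    ∫⁻ a, f a ^ s ∂μ ≤ μ univ ^ (1 - s) * (∫⁻ a, f a ∂μ) ^ s := by
  have hpq : (1 / s).HolderConjugate (1 / (1 - s)) := by
    rw [Real.holderConjugate_iff]
    refine ⟨by rw [lt_div_iff₀ hs0]; linarith, by simp⟩
  have h := ENNReal.lintegral_mul_le_Lp_mul_Lq μ hpq (hf.pow_const s)
    (aemeasurable_const (b := (1 : ℝ≥0∞)))
  simpa [← ENNReal.rpow_mul, mul_inv_cancel₀ hs0.ne', mul_comm] using h

/-- After the weighted Cauchy–Schwarz inequality, Tonelli puts the mild power `k^s` under an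
integral over `D` alone; this is where the smallness of `D` is gained. Translation invariance makes
both kernel integrals independent of the base point. -/
theorem lintegral_sq_rieszPotential_le {G : Plane → ℝ≥0∞} (hG : Measurable G) (D : Set Plane)
    (d : ℝ) {s : ℝ} (hs0 : 0 < s) (hs1 : s < 1) :
    ∫⁻ x in D, (∫⁻ z, G z * rieszKernel d (z - x)) ^ 2 ≤
      (∫⁻ h, rieszKernel d h ^ (2 - s)) * (volume D ^ (1 - s) * (∫⁻ h, rieszKernel d h) ^ s) *
        ∫⁻ z, G z ^ 2 := by
  have hk := measurable_rieszKernel d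
  calc ∫⁻ x in D, (∫⁻ z, G z * rieszKernel d (z - x)) ^ 2
      ≤ ∫⁻ x in D, (∫⁻ h, rieszKernel d h ^ (2 - s)) *
          ∫⁻ z, G z ^ 2 * rieszKernel d (z - x) ^ s := by
        refine lintegral_mono fun x => ?_
        refine (sq_lintegral_mul_kernel_le hG.aemeasurable (by fun_prop) hs0.le
          (by linarith)).trans_eq ?_
        rw [lintegral_sub_right_eq_self (fun h => rieszKernel d h ^ (2 - s)) x]
    _ = (∫⁻ h, rieszKernel d h ^ (2 - s)) *
          ∫⁻ z, G z ^ 2 * ∫⁻ x in D, rieszKernel d (z - x) ^ s := by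
        rw [lintegral_const_mul, lintegral_lintegral_swap]
        · congr 1
          refine lintegral_congr fun z => ?_
          rw [lintegral_const_mul]
          fun_prop
        · fun_prop
        · refine Measurable.lintegral_prod_right' (f := fun p : Plane × Plane =>
            G p.2 ^ 2 * rieszKernel d (p.2 - p.1) ^ s) ?_
          fun_prop
    _ ≤ (∫⁻ h, rieszKernel d h ^ (2 - s)) *
          ∫⁻ z, G z ^ 2 * (volume D ^ (1 - s) * (∫⁻ h, rieszKernel d h) ^ s) := by
        gcongr with z
        refine (lintegral_rpow_le_of_lt_one (by fun_prop) hs0 hs1).trans ?_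
        rw [Measure.restrict_apply_univ]
        rw [← lintegral_sub_left_eq_self (rieszKernel d) z]
        gcongr
        exact Measure.restrict_le_self
    _ = _ := by
        rw [lintegral_mul_const _ (by fun_prop)]
        ring

/-! ### Integration along segments and the pointwise potential bound -/

theorem lintegral_comp_smul_plane {f : Plane → ℝ≥0∞} (hf : Measurable f) {t : ℝ} (ht : 0 < t) :
    ∫⁻ h, f (t • h) = ENNReal.ofReal (t ^ (-2 : ℝ)) * ∫⁻ z, f z := by
  have h := Measure.map_addHaar_smul (volume : Measure Plane) ht.ne'
  rw [← lintegral_map (μ := volume) (g := fun h : Plane => t • h) hf (by fun_prop), h,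
    lintegral_smul_measure]
  simp only [finrank_euclideanSpace, Fintype.card_fin, smul_eq_mul]
  rw [abs_of_pos (by positivity), Real.rpow_neg ht.le]
  norm_cast

theorem lintegral_Ioi_rpow_neg_three {a : ℝ} (ha : 0 < a) :
    ∫⁻ t in Ioi a, ENNReal.ofReal (t ^ (-3 : ℝ)) = ENNReal.ofReal (a ^ (-2 : ℝ) / 2) := by
  rw [← ofReal_integral_eq_lintegral_ofReal (integrableOn_Ioi_rpow_of_lt (by norm_num) ha)]
  · rw [integral_Ioi_rpow_of_lt (by norm_num) ha]
    congr 1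
    norm_num
  · filter_upwards [ae_restrict_mem measurableSet_Ioi] with t ht
    exact Real.rpow_nonneg (ha.trans ht).le _

/-- Integrating `t^(-3)` from `‖z‖ / d` to infinity gives `d² / (2‖z‖²)`, and the factor `‖z‖`
leaves `(d²/2) / ‖z‖`. If `‖z‖ ≥ d`, no `t < 1` contributes. -/
theorem norm_mul_lintegral_rpow_neg_three_le {d : ℝ} (hd : 0 < d) (z : Plane) :
    ‖z‖ₑ * ∫⁻ t in Ioo (0 : ℝ) 1, (Ioi (‖z‖ / d)).indicator
        (fun t => ENNReal.ofReal (t ^ (-3 : ℝ))) t ≤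
      ENNReal.ofReal (d ^ 2 / 2) * rieszKernel d z := by
  rcases eq_or_ne z 0 with rfl | hz
  · simp
  have hz' : 0 < ‖z‖ := norm_pos_iff.2 hz
  rw [setLIntegral_indicator measurableSet_Ioi]
  by_cases hzd : ‖z‖ < d
  · calc _ ≤ ‖z‖ₑ * ∫⁻ t in Ioi (‖z‖ / d), ENNReal.ofReal (t ^ (-3 : ℝ)) := by
          gcongr
          exact inter_subset_left
      _ = _ := by
          rw [lintegral_Ioi_rpow_neg_three (by positivity), rieszKernel,
            indicator_of_mem (by simpa using hzd), ← ofReal_norm,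
            ← ENNReal.ofReal_mul (by positivity), ← ENNReal.ofReal_mul (by positivity)]
          congr 1
          rw [Real.rpow_neg (by positivity)]
          norm_cast
          field_simp
  · have : Ioi (‖z‖ / d) ∩ Ioo (0 : ℝ) 1 = ∅ := by
      ext t
      simp only [mem_inter_iff, mem_Ioi, mem_Ioo, mem_empty_iff_false, iff_false, not_and, not_lt]
      intro h _
      exact ((one_le_div hd).2 (not_lt.1 hzd)).trans h.le
    simp [this]

/-- Substitute `z = t h`: the planar Jacobian gives `t^(-2)`, `‖h‖ = ‖z‖ / t` gives one more
`t^(-1)`, and `‖h‖ < d` becomes `t > ‖z‖ / d`. -/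
theorem lintegral_ball_comp_smul_mul_enorm {F : Plane → ℝ≥0∞} (hF : Measurable F) {d t : ℝ}
    (hd : 0 < d) (ht : 0 < t) :
    ∫⁻ h in Metric.ball (0 : Plane) d, F (t • h) * ‖h‖ₑ =
      ∫⁻ z, F z * ‖z‖ₑ *
        (Ioi (‖z‖ / d)).indicator (fun t => ENNReal.ofReal (t ^ (-3 : ℝ))) t := by
  have h1 := lintegral_comp_smul_plane (t := t)
    (f := (Metric.ball (0 : Plane) (t * d)).indicator
      fun z => F z * ‖z‖ₑ * ENNReal.ofReal t⁻¹)
    (Measurable.indicator (by fun_prop) measurableSet_ball) ht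
  have h2 : (fun h : Plane => (Metric.ball (0 : Plane) (t * d)).indicator
      (fun z => F z * ‖z‖ₑ * ENNReal.ofReal t⁻¹) (t • h)) =
      (Metric.ball (0 : Plane) d).indicator fun h => F (t • h) * ‖h‖ₑ := by
    ext h
    have hm : t • h ∈ Metric.ball (0 : Plane) (t * d) ↔ h ∈ Metric.ball (0 : Plane) d := by
      simp [norm_smul, abs_of_pos ht, ht]
    by_cases hh : h ∈ Metric.ball (0 : Plane) d
    · rw [indicator_of_mem (hm.2 hh), indicator_of_mem hh, enorm_smul, Real.enorm_of_nonneg ht.le, mul_assoc, mul_right_comm (ENNReal.ofReal t),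
        ← ENNReal.ofReal_mul ht.le, mul_inv_cancel₀ ht.ne']
      simp
    · rw [indicator_of_notMem (mt hm.1 hh), indicator_of_notMem hh]
  rw [h2, lintegral_indicator measurableSet_ball] at h1
  rw [h1, ← lintegral_const_mul _ (Measurable.indicator (by fun_prop) measurableSet_ball)]
  refine lintegral_congr fun z => ?_
  have hm : z ∈ Metric.ball (0 : Plane) (t * d) ↔ t ∈ Ioi (‖z‖ / d) := by
    simp [div_lt_iff₀ hd]
  by_cases hz : z ∈ Metric.ball (0 : Plane) (t * d)
  · rw [indicator_of_mem hz, indicator_of_mem (hm.1 hz), mul_left_comm, ← ENNReal.ofReal_mul (Real.rpow_nonneg ht.le _)]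
    congr 2
    rw [← Real.rpow_neg_one, ← Real.rpow_add ht]
    norm_num
  · rw [indicator_of_notMem hz, indicator_of_notMem (mt hm.2 hz), mul_zero, mul_zero]

theorem measurable_indicator_rpow_neg_three (d : ℝ) :
    Measurable fun p : Plane × ℝ =>
      (Ioi (‖p.1‖ / d)).indicator (fun t => ENNReal.ofReal (t ^ (-3 : ℝ))) p.2 := by
  have hset : MeasurableSet {p : Plane × ℝ | ‖p.1‖ / d < p.2} :=
    measurableSet_lt (by fun_prop) (by fun_prop)
  convert (by fun_prop : Measurable fun p : Plane × ℝ =>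
    ENNReal.ofReal (p.2 ^ (-3 : ℝ))).indicator hset using 2 with p
  by_cases hp : ‖p.1‖ / d < p.2
  · rw [indicator_of_mem (mem_Ioi.2 hp), indicator_of_mem (by exact hp)]
  · rw [indicator_of_notMem (by simpa using hp), indicator_of_notMem (by exact hp)]

/-- Once `B` is enlarged to the ball around `x`, each fixed `t` can be rescaled by `z = t (y - x)`.
Integrating the resulting weight in `t` for fixed `z` produces the Riesz kernel. -/
theorem lintegral_segments_le {G : Plane → ℝ≥0∞} (hG : Measurable G) {d : ℝ} (hd : 0 < d)
    {x : Plane} {B : Set Plane} (hB : B ⊆ Metric.ball x d) :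
    ∫⁻ y in B, ∫⁻ t in Ioo (0 : ℝ) 1, G (x + t • (y - x)) * ‖y - x‖ₑ ≤
      ENNReal.ofReal (d ^ 2 / 2) * ∫⁻ z, G z * rieszKernel d (z - x) := by
  obtain ⟨J, hJ⟩ : ∃ J : Plane → ℝ → ℝ≥0∞, ∀ z t, J z t =
      (Ioi (‖z‖ / d)).indicator (fun t => ENNReal.ofReal (t ^ (-3 : ℝ))) t := ⟨_, fun _ _ => rfl⟩
  have hJm : Measurable fun p : Plane × ℝ => J p.1 p.2 := by
    simpa only [hJ] using measurable_indicator_rpow_neg_three d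
  have hscale : ∀ t ∈ Ioo (0 : ℝ) 1,
      ∫⁻ h in Metric.ball (0 : Plane) d, G (x + t • h) * ‖h‖ₑ =
        ∫⁻ z, G (x + z) * ‖z‖ₑ * J z t := fun t ht => by
    simp only [hJ]
    exact lintegral_ball_comp_smul_mul_enorm (F := fun z => G (x + z)) (by fun_prop) hd ht.1
  have hJm' : Measurable fun p : ℝ × Plane => J p.2 p.1 := hJm.comp measurable_swap
  have hJm'' : ∀ z, Measurable (J z) := fun z =>
    hJm.comp measurable_prodMk_left
  calc ∫⁻ y in B, ∫⁻ t in Ioo (0 : ℝ) 1, G (x + t • (y - x)) * ‖y - x‖ₑ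
      ≤ ∫⁻ y in Metric.ball x d, ∫⁻ t in Ioo (0 : ℝ) 1, G (x + t • (y - x)) * ‖y - x‖ₑ :=
        lintegral_mono_set hB
    _ = ∫⁻ h in Metric.ball (0 : Plane) d, ∫⁻ t in Ioo (0 : ℝ) 1, G (x + t • h) * ‖h‖ₑ := by
        rw [← lintegral_indicator measurableSet_ball, ← lintegral_indicator measurableSet_ball,
          ← lintegral_sub_right_eq_self (fun h => (Metric.ball (0 : Plane) d).indicator
            (fun h => ∫⁻ t in Ioo (0 : ℝ) 1, G (x + t • h) * ‖h‖ₑ) h) x]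
        refine lintegral_congr fun y => ?_
        have hm : y - x ∈ Metric.ball (0 : Plane) d ↔ y ∈ Metric.ball x d := by
          rw [mem_ball_zero_iff, mem_ball_iff_norm]
        by_cases hy : y ∈ Metric.ball x d
        · rw [indicator_of_mem hy, indicator_of_mem (hm.2 hy)]
        · rw [indicator_of_notMem hy, indicator_of_notMem (mt hm.1 hy)]
    _ = ∫⁻ t in Ioo (0 : ℝ) 1, ∫⁻ h in Metric.ball (0 : Plane) d, G (x + t • h) * ‖h‖ₑ := by
        rw [lintegral_lintegral_swap]
        fun_prop
    _ = ∫⁻ t in Ioo (0 : ℝ) 1, ∫⁻ z, G (x + z) * ‖z‖ₑ * J z t :=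
        setLIntegral_congr_fun measurableSet_Ioo hscale
    _ = ∫⁻ z, G (x + z) * (‖z‖ₑ * ∫⁻ t in Ioo (0 : ℝ) 1, J z t) := by
        rw [lintegral_lintegral_swap]
        · refine lintegral_congr fun z => ?_
          rw [lintegral_const_mul _ (hJm'' z), mul_assoc]
        · exact ((by fun_prop : Measurable fun p : ℝ × Plane => G (x + p.2) * ‖p.2‖ₑ).mul
            hJm').aemeasurable
    _ ≤ ∫⁻ z, G (x + z) * (ENNReal.ofReal (d ^ 2 / 2) * rieszKernel d z) := by
        refine lintegral_mono fun z => ?_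
        refine mul_le_mul' le_rfl ?_
        simp only [hJ]
        exact norm_mul_lintegral_rpow_neg_three_le hd z
    _ = ENNReal.ofReal (d ^ 2 / 2) * ∫⁻ z, G (x + z) * rieszKernel d z := by
        have := measurable_rieszKernel d
        rw [← lintegral_const_mul _ (by fun_prop)]
        exact lintegral_congr fun z => by ring
    _ = _ := by
        rw [← lintegral_sub_right_eq_self (fun z => G (x + z) * rieszKernel d z) x]
        simp

theorem enorm_le_add_lintegral_segment {u : Plane → ℝ} (hu : ContDiff ℝ 1 u) (x y : Plane) :
    ‖u x‖ₑ ≤ ‖u y‖ₑ +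
      ∫⁻ t in Ioo (0 : ℝ) 1, ‖fderiv ℝ u (x + t • (y - x))‖ₑ * ‖y - x‖ₑ := by
  have hc : ∀ t : ℝ, HasDerivAt (fun t : ℝ => u (x + t • (y - x)))
      (fderiv ℝ u (x + t • (y - x)) (y - x)) t := fun t => by
    have h1 : HasDerivAt (fun t : ℝ => x + t • (y - x)) (y - x) t := by
      simpa using ((hasDerivAt_id t).smul_const (y - x)).const_add x
    exact ((hu.differentiable one_ne_zero _).hasFDerivAt).comp_hasDerivAt t h1
  have h := enorm_sub_le_lintegral_deriv_of_contDiffOn_Icc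
    (f := fun t : ℝ => u (x + t • (y - x))) (a := 0) (b := 1)
    (hu.comp (by fun_prop)).contDiffOn zero_le_one
  simp only [zero_smul, one_smul, add_zero, add_sub_cancel] at h
  have h2 : ‖u x‖ₑ ≤ ‖u y‖ₑ + ‖u y - u x‖ₑ := by
    calc ‖u x‖ₑ = ‖u y - (u y - u x)‖ₑ := by congr 1; ring
      _ ≤ _ := enorm_sub_le
  refine h2.trans (add_le_add_right (h.trans ?_) _)
  rw [restrict_Ioo_eq_restrict_Icc]
  refine lintegral_mono fun t => ?_
  rw [(hc t).deriv]
  exact ContinuousLinearMap.le_opENorm _ _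

/-- The fundamental theorem of calculus on each segment is integrated over the endpoint `y ∈ B`.
Convexity keeps the segment in `S`, the only place where `G` has to dominate the gradient. -/
theorem measure_mul_enorm_le {u : Plane → ℝ} (hu : ContDiff ℝ 1 u) {S : Set Plane}
    (hS : Convex ℝ S) {G : Plane → ℝ≥0∞} (hG : Measurable G)
    (hGu : ∀ z ∈ S, ‖fderiv ℝ u z‖ₑ ≤ G z) {B : Set Plane} (hB : MeasurableSet B) (hBS : B ⊆ S)
    {d : ℝ} (hd : 0 < d) {x : Plane} (hx : x ∈ S) (hBx : B ⊆ Metric.ball x d) :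
    volume B * ‖u x‖ₑ ≤ (∫⁻ y in B, ‖u y‖ₑ) +
      ENNReal.ofReal (d ^ 2 / 2) * ∫⁻ z, G z * rieszKernel d (z - x) := by
  calc volume B * ‖u x‖ₑ = ∫⁻ _ in B, ‖u x‖ₑ := by rw [setLIntegral_const, mul_comm]
    _ ≤ ∫⁻ y in B, (‖u y‖ₑ +
          ∫⁻ t in Ioo (0 : ℝ) 1, G (x + t • (y - x)) * ‖y - x‖ₑ) := by
        refine setLIntegral_mono' hB fun y hy => ?_
        refine (enorm_le_add_lintegral_segment hu x y).trans ?_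
        refine add_le_add_right ?_ _
        refine setLIntegral_mono' measurableSet_Ioo fun t ht => ?_
        gcongr
        exact hGu _ (hS.add_smul_sub_mem hx (hBS hy) ⟨ht.1.le, ht.2.le⟩)
    _ = (∫⁻ y in B, ‖u y‖ₑ) +
          ∫⁻ y in B, ∫⁻ t in Ioo (0 : ℝ) 1, G (x + t • (y - x)) * ‖y - x‖ₑ :=
        lintegral_add_left hu.continuous.measurable.enorm _
    _ ≤ _ := by
        gcongr
        exact lintegral_segments_le hG hd hBx

/-! ### Mollification: L² contraction and weak derivatives -/

/-- The mollification of a nonnegative function, as a Lebesgue integral. -/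
noncomputable def lmollify (φ : ContDiffBump (0 : Plane)) (f : Plane → ℝ≥0∞) (z : Plane) : ℝ≥0∞ :=
  ∫⁻ y, f y * ENNReal.ofReal (φ.normed volume (z - y))

theorem measurable_ofReal_normed (φ : ContDiffBump (0 : Plane)) :
    Measurable fun x => ENNReal.ofReal (φ.normed volume x) :=
  (φ.contDiff_normed (n := 1)).continuous.measurable.ennreal_ofReal

theorem lintegral_ofReal_normed (φ : ContDiffBump (0 : Plane)) :
    ∫⁻ x, ENNReal.ofReal (φ.normed volume x) = 1 := by
  rw [← ofReal_integral_eq_lintegral_ofReal φ.integrable_normed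
    (Eventually.of_forall φ.nonneg_normed), φ.integral_normed, ENNReal.ofReal_one]

theorem lmollify_congr_ae (φ : ContDiffBump (0 : Plane)) {f g : Plane → ℝ≥0∞}
    (h : f =ᵐ[volume] g) : lmollify φ f = lmollify φ g := by
  ext z
  refine lintegral_congr_ae ?_
  filter_upwards [h] with y hy
  rw [hy]

theorem measurable_lmollify (φ : ContDiffBump (0 : Plane)) {f : Plane → ℝ≥0∞}
    (hf : AEMeasurable f) : Measurable (lmollify φ f) := by
  rw [lmollify_congr_ae φ hf.ae_eq_mk]
  have h1 := hf.measurable_mk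
  have h2 := measurable_ofReal_normed φ
  refine Measurable.lintegral_prod_right' (f := fun p : Plane × Plane =>
    hf.mk f p.2 * ENNReal.ofReal (φ.normed volume (p.1 - p.2))) ?_
  exact (h1.comp measurable_snd).mul (h2.comp (measurable_fst.sub measurable_snd))

/-- Since the bump has mass 1, Cauchy–Schwarz bounds the square of the average by the average of the
square; Tonelli and mass 1 again finish. -/
theorem lintegral_sq_lmollify_le (φ : ContDiffBump (0 : Plane)) {f : Plane → ℝ≥0∞}
    (hf : AEMeasurable f) : ∫⁻ z, lmollify φ f z ^ 2 ≤ ∫⁻ y, f y ^ 2 := by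
  have h2 := measurable_ofReal_normed φ
  have h3 : Measurable fun p : Plane × Plane =>
      ENNReal.ofReal (φ.normed volume (p.1 - p.2)) := h2.comp (measurable_fst.sub measurable_snd)
  have h4 : ∀ z : Plane, Measurable fun y => ENNReal.ofReal (φ.normed volume (z - y)) :=
    fun z => h2.comp (measurable_const.sub measurable_id)
  have h5 : ∀ y : Plane, Measurable fun z => ENNReal.ofReal (φ.normed volume (z - y)) :=
    fun y => h2.comp (measurable_id.sub measurable_const)
  calc ∫⁻ z, lmollify φ f z ^ 2
      ≤ ∫⁻ z, ∫⁻ y, f y ^ 2 * ENNReal.ofReal (φ.normed volume (z - y)) := by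
        refine lintegral_mono fun z => ?_
        have h := sq_lintegral_mul_kernel_le (s := 1) hf (h4 z).aemeasurable zero_le_one one_le_two
        have h1 : (2 : ℝ) - 1 = 1 := by norm_num
        simp only [h1, ENNReal.rpow_one] at h
        rwa [lintegral_sub_left_eq_self (fun x => ENNReal.ofReal (φ.normed volume x)) z,
          lintegral_ofReal_normed, one_mul] at h
    _ = ∫⁻ y, f y ^ 2 * ∫⁻ z, ENNReal.ofReal (φ.normed volume (z - y)) := by
        rw [lintegral_lintegral_swap]
        · exact lintegral_congr fun y => lintegral_const_mul _ (h5 y)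
        · exact ((hf.pow_const 2).comp_snd).mul h3.aemeasurable
    _ = ∫⁻ y, f y ^ 2 := by
        refine lintegral_congr fun y => ?_
        rw [lintegral_sub_right_eq_self (fun x => ENNReal.ofReal (φ.normed volume x)) y,
          lintegral_ofReal_normed, mul_one]

theorem enorm_integral_mul_normed_le (φ : ContDiffBump (0 : Plane)) (g : Plane → ℝ) (x : Plane) :
    ‖∫ y, g y * φ.normed volume (x - y)‖ₑ ≤ lmollify φ (fun y => ‖g y‖ₑ) x := by
  refine (enorm_integral_le_lintegral_enorm _).trans_eq (lintegral_congr fun y => ?_)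
  rw [enorm_mul, Real.enorm_of_nonneg (φ.nonneg_normed _)]

/-- The mollification of a function by a normalized bump. -/
noncomputable def mollify (φ : ContDiffBump (0 : Plane)) (g : Plane → ℝ) : Plane → ℝ :=
  φ.normed volume ⋆[ContinuousLinearMap.lsmul ℝ ℝ, volume] g

theorem mollify_apply (φ : ContDiffBump (0 : Plane)) (g : Plane → ℝ) (x : Plane) :
    mollify φ g x = ∫ y, g y * φ.normed volume (x - y) := by
  rw [mollify, convolution_eq_swap]
  simp [mul_comm]

theorem enorm_mollify_le (φ : ContDiffBump (0 : Plane)) (g : Plane → ℝ) (x : Plane) :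
    ‖mollify φ g x‖ₑ ≤ lmollify φ (fun y => ‖g y‖ₑ) x := by
  rw [mollify_apply]
  exact enorm_integral_mul_normed_le φ g x

theorem contDiff_mollify (φ : ContDiffBump (0 : Plane)) {g : Plane → ℝ}
    (hg : LocallyIntegrable g) : ContDiff ℝ 1 (mollify φ g) :=
  φ.hasCompactSupport_normed.contDiff_convolution_left _ φ.contDiff_normed hg

theorem fderiv_mollify_apply (φ : ContDiffBump (0 : Plane)) {g : Plane → ℝ}
    (hg : LocallyIntegrable g) (x e : Plane) :
    fderiv ℝ (mollify φ g) x e = ∫ y, g y * fderiv ℝ (φ.normed volume) (x - y) e := by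
  have hρ : ContDiff ℝ 1 (φ.normed volume) := φ.contDiff_normed
  have h := φ.hasCompactSupport_normed (μ := volume).hasFDerivAt_convolution_left
    (ContinuousLinearMap.lsmul ℝ ℝ) hρ hg x
  have hex : ConvolutionExistsAt (fderiv ℝ (φ.normed volume)) g x
      ((ContinuousLinearMap.lsmul ℝ ℝ).precompL Plane) volume :=
    (φ.hasCompactSupport_normed.fderiv ℝ).convolutionExists_left _
      (hρ.continuous_fderiv one_ne_zero) hg x
  rw [mollify, h.fderiv, convolution_def, ContinuousLinearMap.integral_apply hex,
    ← integral_sub_left_eq_self _ volume x]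
  refine integral_congr_ae (Eventually.of_forall fun y => ?_)
  simp [mul_comm]

theorem isTestFunction_normed_sub (φ : ContDiffBump (0 : Plane)) {Ω : Set Plane} {x : Plane}
    (hx : Metric.closedBall x φ.rOut ⊆ Ω) :
    IsTestFunction Ω fun y => φ.normed volume (x - y) := by
  have hts : tsupport (fun y => φ.normed volume (x - y)) ⊆ Metric.closedBall x φ.rOut := by
    refine closure_minimal (fun y hy => ?_) Metric.isClosed_closedBall
    have h1 : x - y ∈ tsupport (φ.normed volume) := subset_tsupport _ hy
    rw [φ.tsupport_normed_eq, mem_closedBall_zero_iff] at h1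
    rwa [mem_closedBall_iff_norm, norm_sub_rev]
  exact ⟨φ.contDiff_normed.comp (contDiff_const.sub contDiff_id),
    HasCompactSupport.of_support_subset_isCompact (isCompact_closedBall x φ.rOut)
      ((subset_tsupport _).trans hts), hts.trans hx⟩

theorem partialDeriv_normed_sub (φ : ContDiffBump (0 : Plane)) (i : Fin 2) (x y : Plane) :
    partialDeriv i (fun y => φ.normed volume (x - y)) y =
      -fderiv ℝ (φ.normed volume) (x - y) (EuclideanSpace.single i 1) := by
  have hρ : ContDiff ℝ 1 (φ.normed volume) := φ.contDiff_normed
  have h1 : HasFDerivAt (fun y : Plane => x - y) (-ContinuousLinearMap.id ℝ Plane) y :=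
    (hasFDerivAt_id y).const_sub x
  have h := (hρ.differentiable one_ne_zero (x - y)).hasFDerivAt.comp y h1
  rw [partialDeriv]
  erw [h.fderiv]
  simp

/-- If the ball around `x` lies in `Ω`, then `y ↦ ρ(x - y)`, with `ρ` the normalized bump, is a test
function on `Ω`. The minus sign from the chain rule cancels the one in the definition of the weak
derivative, so the derivative of the mollification is the mollification of `w`. -/
theorem enorm_fderiv_mollify_single_le (φ : ContDiffBump (0 : Plane)) {Ω : Set Plane}
    (hΩ : MeasurableSet Ω) {v w : Plane → ℝ} (hv : LocallyIntegrable (Ω.indicator v)) {i : Fin 2}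
    (hw : IsWeakPartial Ω i v w) {x : Plane} (hx : Metric.closedBall x φ.rOut ⊆ Ω) :
    ‖fderiv ℝ (mollify φ (Ω.indicator v)) x (EuclideanSpace.single i 1)‖ₑ ≤
      lmollify φ (fun y => ‖Ω.indicator w y‖ₑ) x := by
  have h := hw.2 _ (isTestFunction_normed_sub φ hx)
  have key : fderiv ℝ (mollify φ (Ω.indicator v)) x (EuclideanSpace.single i 1) =
      ∫ y, Ω.indicator w y * φ.normed volume (x - y) := by
    have hmul : ∀ (a b : Plane → ℝ) y, Ω.indicator a y * b y = Ω.indicator (fun y => a y * b y) y :=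
      fun a b y => (indicator_mul_left Ω a b).symm
    rw [fderiv_mollify_apply φ hv]
    simp only [hmul _ (fun y => φ.normed volume (x - y)),
      hmul _ (fun y => fderiv ℝ (φ.normed volume) (x - y) (EuclideanSpace.single i 1))]
    rw [integral_indicator hΩ, integral_indicator hΩ, ← neg_eq_iff_eq_neg.2 h, ← integral_neg]
    simp only [partialDeriv_normed_sub, mul_neg, neg_neg]
  rw [key]
  exact enorm_integral_mul_normed_le φ _ x

/-! ### Auxiliary inequalities and the passage to the limit -/

theorem enorm_clm_le_sum (L : Plane →L[ℝ] ℝ) :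
    ‖L‖ₑ ≤ ∑ i : Fin 2, ‖L (EuclideanSpace.single i 1)‖ₑ := by
  have h : ‖L‖ ≤ ∑ i : Fin 2, ‖L (EuclideanSpace.single i 1)‖ := by
    refine L.opNorm_le_bound (by positivity) fun x => ?_
    have hx : x = ∑ i : Fin 2, x i • EuclideanSpace.single i (1 : ℝ) := by
      ext j
      fin_cases j <;> simp
    calc ‖L x‖ = ‖∑ i : Fin 2, x i • L (EuclideanSpace.single i 1)‖ := by
          conv_lhs => rw [hx]
          simp only [map_sum, map_smul]
      _ ≤ ∑ i : Fin 2, ‖x‖ * ‖L (EuclideanSpace.single i 1)‖ := by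
          refine (norm_sum_le _ _).trans (Finset.sum_le_sum fun i _ => ?_)
          rw [norm_smul]
          gcongr
          exact PiLp.norm_apply_le x i
      _ = _ := by rw [← Finset.mul_sum, mul_comm]
  rw [← ofReal_norm]
  refine (ENNReal.ofReal_le_ofReal h).trans_eq ?_
  rw [ENNReal.ofReal_sum_of_nonneg fun _ _ => norm_nonneg _]
  simp only [ofReal_norm]

/-- This inner set is where the gradient of the mollification is controlled, and the segment
argument needs it convex. Displace both endpoints by the same vector `h`: `z = a (x + h) + b (y +
h)`. -/
theorem convex_setOf_closedBall_subset {Ω : Set Plane} (hΩ : Convex ℝ Ω) (δ : ℝ) :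
    Convex ℝ {x : Plane | Metric.closedBall x δ ⊆ Ω} := by
  intro x hx y hy a b ha hb hab z hz
  set h := z - (a • x + b • y) with hh
  have hn : ‖h‖ ≤ δ := by rwa [mem_closedBall_iff_norm] at hz
  have h1 : x + h ∈ Ω := hx (by simpa [mem_closedBall_iff_norm] using hn)
  have h2 : y + h ∈ Ω := hy (by simpa [mem_closedBall_iff_norm] using hn)
  have h3 : z = a • (x + h) + b • (y + h) := by
    have : a • h + b • h = h := by rw [← add_smul, hab, one_smul]
    rw [smul_add, smul_add, add_add_add_comm, this, hh]
    abel
  rw [h3]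
  exact hΩ h1 h2 ha hb hab

theorem add_sq_le_two_mul (a b : ℝ≥0∞) : (a + b) ^ 2 ≤ 2 * (a ^ 2 + b ^ 2) := by
  have h := ENNReal.rpow_add_le_mul_rpow_add_rpow a b (p := 2) one_le_two
  norm_num at h
  exact h

theorem ofReal_rpow_le_self {a s : ℝ} (ha : 1 ≤ a) (hs : s ≤ 1) :
    ENNReal.ofReal a ^ s ≤ ENNReal.ofReal a := by
  have h1 : (1 : ℝ≥0∞) ≤ ENNReal.ofReal a := by simpa using ha
  simpa using ENNReal.rpow_le_rpow_of_exponent_le h1 hs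

/-- The assumption `1 ≤ d` allows `d^s ≤ d` and `(2πd)^s ≤ 2πd`, so that `1 / s` and `|D|^(1-s)` are
the only dependence on `s` left. -/
theorem lintegral_sq_rieszPotential_le_ofReal {G : Plane → ℝ≥0∞} (hG : Measurable G)
    (D : Set Plane) {d : ℝ} (hd : 1 ≤ d) {s : ℝ} (hs0 : 0 < s) (hs1 : s < 1) :
    ∫⁻ x in D, (∫⁻ z, G z * rieszKernel d (z - x)) ^ 2 ≤
      ENNReal.ofReal (2 * Real.pi * d) ^ 2 * ENNReal.ofReal (1 / s) *
        volume D ^ (1 - s) * ∫⁻ z, G z ^ 2 := by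
  have hd0 : 0 < d := by linarith
  have hp : 1 ≤ 2 * Real.pi * d := by nlinarith [Real.pi_gt_three]
  have h1 : ∫⁻ h, rieszKernel d h = ENNReal.ofReal (2 * Real.pi * d) := by
    have := lintegral_rieszKernel_rpow hd0 one_pos one_lt_two
    norm_num at this
    exact this
  have h2 : ∫⁻ h, rieszKernel d h ^ (2 - s) ≤
      ENNReal.ofReal (2 * Real.pi * d) * ENNReal.ofReal (1 / s) := by
    rw [lintegral_rieszKernel_rpow hd0 (by linarith) (by linarith), _root_.sub_sub_cancel,
      ← ENNReal.ofReal_mul (by positivity), mul_one_div]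
    gcongr
    simpa using Real.rpow_le_rpow_of_exponent_le hd hs1.le
  calc _ ≤ _ := lintegral_sq_rieszPotential_le hG D d hs0 hs1
    _ ≤ (ENNReal.ofReal (2 * Real.pi * d) * ENNReal.ofReal (1 / s)) *
        (volume D ^ (1 - s) * ENNReal.ofReal (2 * Real.pi * d)) * ∫⁻ z, G z ^ 2 := by
      rw [h1]
      gcongr
      exact ofReal_rpow_le_self hp hs1.le
    _ = _ := by ring

theorem measure_le_rpow_mul {D Ω : Set Plane} (hD : D ⊆ Ω) {s : ℝ} (hs0 : 0 < s) (hs1 : s < 1) :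
    volume D ≤ volume D ^ (1 - s) * max 1 (volume Ω) := by
  calc volume D = volume D ^ (1 - s) * volume D ^ s := by
        rw [← ENNReal.rpow_add_of_nonneg _ _ (by linarith) hs0.le]
        simp
    _ ≤ volume D ^ (1 - s) * (max 1 (volume Ω)) ^ (1 : ℝ) := by
        gcongr
        refine (ENNReal.rpow_le_rpow ((measure_mono hD).trans (le_max_right 1 _)) hs0.le).trans ?_
        exact ENNReal.rpow_le_rpow_of_exponent_le (le_max_left _ _) hs1.le
    _ = _ := by rw [ENNReal.rpow_one]

/-- Fatou's lemma. The pointwise bound is needed only for large `n`, with a threshold depending on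
`x`, so points of `D` may approach the boundary of `Ω`. -/
theorem sq_mul_lintegral_le_of_ae_tendsto {D : Set Plane} {b M : ℝ≥0∞} (hb : b ≠ ⊤) {v : Plane → ℝ}
    (hv : AEMeasurable v (volume.restrict D)) {u : ℕ → Plane → ℝ}
    (hu : ∀ᵐ x ∂volume.restrict D, Tendsto (fun n => u n x) atTop (𝓝 (v x)))
    {F : ℕ → Plane → ℝ≥0∞} (hF : ∀ n, Measurable (F n))
    (huF : ∀ᵐ x ∂volume.restrict D, ∀ᶠ n in atTop, b * ‖u n x‖ₑ ≤ F n x)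
    (hM : ∀ n, ∫⁻ x in D, F n x ^ 2 ≤ M) :
    b ^ 2 * ∫⁻ x in D, ‖v x‖ₑ ^ 2 ≤ M := by
  calc b ^ 2 * ∫⁻ x in D, ‖v x‖ₑ ^ 2 = ∫⁻ x in D, (b * ‖v x‖ₑ) ^ 2 := by
        rw [← lintegral_const_mul'' _ (hv.enorm.pow_const 2)]
        simp only [mul_pow]
    _ ≤ ∫⁻ x in D, liminf (fun n => F n x ^ 2) atTop := by
        refine lintegral_mono_ae ?_
        filter_upwards [hu, huF] with x hx hxF
        have h1 : Tendsto (fun n => (b * ‖u n x‖ₑ) ^ 2) atTop (𝓝 ((b * ‖v x‖ₑ) ^ 2)) :=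
          ((ENNReal.continuous_pow 2).tendsto _).comp
            (ENNReal.Tendsto.const_mul ((continuous_enorm.tendsto _).comp hx) (Or.inr hb))
        rw [← h1.liminf_eq]
        refine liminf_le_liminf ?_
        filter_upwards [hxF] with n hn
        gcongr
    _ ≤ liminf (fun n => ∫⁻ x in D, F n x ^ 2) atTop :=
        lintegral_liminf_le fun n => (hF n).pow_const 2
    _ ≤ liminf (fun _ : ℕ => M) atTop := liminf_le_liminf (Eventually.of_forall hM)
    _ = M := liminf_const M

theorem lintegral_sq_indicator_enorm {Ω : Set Plane} (hΩ : MeasurableSet Ω) (f : Plane → ℝ) :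
    ∫⁻ y, ‖Ω.indicator f y‖ₑ ^ 2 = ∫⁻ y in Ω, ‖f y‖ₑ ^ 2 := by
  rw [← lintegral_indicator hΩ]
  refine lintegral_congr fun y => ?_
  by_cases hy : y ∈ Ω
  · rw [indicator_of_mem hy, indicator_of_mem hy]
  · rw [indicator_of_notMem hy, indicator_of_notMem hy]
    simp

theorem sq_setLIntegral_le {f : Plane → ℝ≥0∞} (hf : Measurable f) (B : Set Plane) :
    (∫⁻ y in B, f y) ^ 2 ≤ (∫⁻ y, f y ^ 2) * volume B := by
  have h := sq_lintegral_mul_le (μ := volume.restrict B) hf.aemeasurable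
    (aemeasurable_const (b := (1 : ℝ≥0∞)))
  simp only [mul_one, one_pow, lintegral_one, Measure.restrict_apply_univ] at h
  refine h.trans ?_
  gcongr
  exact Measure.restrict_le_self

/-! ### The estimate for weakly differentiable functions -/

theorem sq_measure_ball_mul_lintegral_le {Ω : Set Plane} (hΩo : IsOpen Ω) (hΩc : Convex ℝ Ω)
    {d : ℝ} (hd : 1 ≤ d) (hΩd : ∀ x ∈ Ω, ∀ y ∈ Ω, dist x y < d) {p : Plane} {r : ℝ} (hr : 0 < r)
    (hp : Metric.closedBall p (2 * r) ⊆ Ω) {v : Plane → ℝ} {w : Fin 2 → Plane → ℝ}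
    (hv : MemLp v 2 (volume.restrict Ω)) (hw : ∀ i, IsWeakPartial Ω i v (w i)) {D : Set Plane}
    (hDm : NullMeasurableSet D volume) (hD : D ⊆ Ω) {s : ℝ} (hs0 : 0 < s) (hs1 : s < 1) :
    volume (Metric.ball p r) ^ 2 * ∫⁻ x in D, ‖v x‖ₑ ^ 2 ≤
      (2 * volume (Metric.ball p r) * max 1 (volume Ω) +
        4 * (ENNReal.ofReal (d ^ 2 / 2) * ENNReal.ofReal (2 * Real.pi * d)) ^ 2) *
      (ENNReal.ofReal (1 / s) * volume D ^ (1 - s) *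
        ((∫⁻ x in Ω, ‖v x‖ₑ ^ 2) + ∑ i, ∫⁻ x in Ω, ‖w i x‖ₑ ^ 2)) := by
  have hΩm := hΩo.measurableSet
  set B := Metric.ball p r
  set c := ENNReal.ofReal (d ^ 2 / 2)
  -- The extension by zero may fail to be weakly differentiable across the boundary of `Ω`. Only its
  -- integrability is used globally; derivatives are taken at inner points.
  have hv0 : MemLp (Ω.indicator v) 2 volume := (memLp_indicator_iff_restrict hΩm).2 hv
  have hvl : LocallyIntegrable (Ω.indicator v) := hv0.locallyIntegrable (by norm_num)
  have hw0 : ∀ i, MemLp (Ω.indicator (w i)) 2 volume := fun i =>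
    (memLp_indicator_iff_restrict hΩm).2 (hw i).1
  have hvm : AEMeasurable fun y => ‖Ω.indicator v y‖ₑ := hv0.1.enorm
  have hwm : ∀ i, AEMeasurable fun y => ‖Ω.indicator (w i) y‖ₑ := fun i => (hw0 i).1.enorm
  -- The fixed ratio 2 of outer to inner radius is what the almost everywhere convergence requires.
  -- Outer radii at most `r` keep `B` inside every inner set, because the ball of radius `2r` lies
  -- in `Ω`.
  let φ : ℕ → ContDiffBump (0 : Plane) := fun n =>
    ⟨r / (n + 1) / 2, r / (n + 1), by positivity, half_lt_self (by positivity)⟩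
  have hφout : ∀ n, (φ n).rOut = r / (n + 1) := fun n => rfl
  have hφ0 : Tendsto (fun n => (φ n).rOut) atTop (𝓝 0) := by
    simpa only [hφout, mul_one_div, mul_zero] using
      tendsto_one_div_add_atTop_nhds_zero_nat.const_mul r
  have hφle : ∀ n, (φ n).rOut ≤ r := fun n => by
    rw [hφout]
    exact div_le_self hr.le (by simp)
  have hlim : ∀ᵐ x, Tendsto (fun n => mollify (φ n) (Ω.indicator v) x) atTop
      (𝓝 (Ω.indicator v x)) :=
    ContDiffBump.ae_convolution_tendsto_right_of_locallyIntegrable (K := 2) hφ0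
      (Eventually.of_forall fun n => by
        change r / (n + 1) ≤ 2 * (r / (n + 1) / 2)
        linarith) hvl
  let G : ℕ → Plane → ℝ≥0∞ := fun n z =>
    ∑ i, lmollify (φ n) (fun y => ‖Ω.indicator (w i) y‖ₑ) z
  have hGm : ∀ n, Measurable (G n) := fun n =>
    Finset.measurable_fun_sum _ fun i _ => measurable_lmollify _ (hwm i)
  have hGsq : ∀ n, ∫⁻ z, G n z ^ 2 ≤ 2 * ∑ i, ∫⁻ x in Ω, ‖w i x‖ₑ ^ 2 := by
    intro n
    have hm : ∀ i, Measurable fun z =>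
        lmollify (φ n) (fun y => ‖Ω.indicator (w i) y‖ₑ) z ^ 2 :=
      fun i => (measurable_lmollify _ (hwm i)).pow_const 2
    calc ∫⁻ z, G n z ^ 2
        ≤ ∫⁻ z, 2 * ∑ i, lmollify (φ n) (fun y => ‖Ω.indicator (w i) y‖ₑ) z ^ 2 := by
          refine lintegral_mono fun z => ?_
          simp only [G, Fin.sum_univ_two]
          exact add_sq_le_two_mul _ _
      _ = 2 * ∑ i, ∫⁻ z, lmollify (φ n) (fun y => ‖Ω.indicator (w i) y‖ₑ) z ^ 2 := by
          rw [lintegral_const_mul _ (Finset.measurable_fun_sum _ fun i _ => hm i),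
            lintegral_finsetSum _ fun i _ => hm i]
      _ ≤ _ := by
          simp only [← lintegral_sq_indicator_enorm hΩm]
          refine mul_le_mul' le_rfl (Finset.sum_le_sum fun i _ => ?_)
          exact lintegral_sq_lmollify_le _ (hwm i)
  let A : ℕ → ℝ≥0∞ := fun n => ∫⁻ y in B, lmollify (φ n) (fun y => ‖Ω.indicator v y‖ₑ) y
  have hA : ∀ n, A n ^ 2 ≤ (∫⁻ x in Ω, ‖v x‖ₑ ^ 2) * volume B := fun n => by
    refine (sq_setLIntegral_le (measurable_lmollify _ hvm) B).trans ?_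
    rw [← lintegral_sq_indicator_enorm hΩm]
    exact mul_le_mul' (lintegral_sq_lmollify_le _ hvm) le_rfl
  have hIm : ∀ n, Measurable fun x => ∫⁻ z, G n z * rieszKernel d (z - x) := fun n => by
    have := measurable_rieszKernel d
    have := hGm n
    refine Measurable.lintegral_prod_right' (f := fun q : Plane × Plane =>
      G n q.2 * rieszKernel d (q.2 - q.1)) ?_
    fun_prop
  have hBS : ∀ n, B ⊆ {x : Plane | Metric.closedBall x (φ n).rOut ⊆ Ω} := fun n y hy => by
    refine (Metric.closedBall_subset_closedBall' ?_).trans hp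
    have : dist y p < r := hy
    linarith [hφle n]
  have hBΩ : B ⊆ Ω := (Metric.ball_subset_closedBall.trans
    (Metric.closedBall_subset_closedBall (by linarith))).trans hp
  have hbound : ∀ n x, Metric.closedBall x (φ n).rOut ⊆ Ω →
      volume B * ‖mollify (φ n) (Ω.indicator v) x‖ₑ ≤
        A n + c * ∫⁻ z, G n z * rieszKernel d (z - x) := by
    intro n x hx
    have hxΩ : x ∈ Ω := hx (Metric.mem_closedBall_self (φ n).rOut_pos.le)
    refine (measure_mul_enorm_le (contDiff_mollify (φ n) hvl)
      (convex_setOf_closedBall_subset hΩc (φ n).rOut) (hGm n) (fun z hz => ?_)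
      measurableSet_ball (hBS n) (by linarith) hx
      (fun y hy => hΩd y (hBΩ hy) x hxΩ)).trans ?_
    · refine (enorm_clm_le_sum _).trans (Finset.sum_le_sum fun i _ => ?_)
      exact enorm_fderiv_mollify_single_le (φ n) hΩm hvl (hw i) hz
    · gcongr
      exact lintegral_mono fun y => enorm_mollify_le _ _ _
  refine sq_mul_lintegral_le_of_ae_tendsto (u := fun n => mollify (φ n) (Ω.indicator v))
    (F := fun n x => A n + c * ∫⁻ z, G n z * rieszKernel d (z - x))
    measure_ball_lt_top.ne (hv.1.aemeasurable.mono_measure (Measure.restrict_mono hD le_rfl))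
    ?_ (fun n => ((hIm n).const_mul c).const_add _) ?_ fun n => ?_
  · filter_upwards [ae_restrict_of_ae hlim, ae_restrict_mem₀ hDm] with x hx hxD
    rwa [indicator_of_mem (hD hxD)] at hx
  · filter_upwards [ae_restrict_mem₀ hDm] with x hxD
    obtain ⟨δ, hδ, hδΩ⟩ := Metric.nhds_basis_closedBall.mem_iff.1 (hΩo.mem_nhds (hD hxD))
    filter_upwards [hφ0.eventually_le_const hδ] with n hn
    exact hbound n x ((Metric.closedBall_subset_closedBall hn).trans hδΩ)
  · set V := ∫⁻ x in Ω, ‖v x‖ₑ ^ 2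
    set W := ∑ i, ∫⁻ x in Ω, ‖w i x‖ₑ ^ 2
    set T := ENNReal.ofReal (1 / s) * volume D ^ (1 - s)
    -- The mean-value term carries `|D|` and no `1 / s`; as `1 / s ≥ 1`, it is absorbed into the
    -- same factor `T` as the potential term.
    have hs : 1 ≤ ENNReal.ofReal (1 / s) := by
      rw [ENNReal.one_le_ofReal, le_div_iff₀ hs0]
      linarith
    have hDT : volume D ≤ max 1 (volume Ω) * T := by
      calc volume D ≤ volume D ^ (1 - s) * max 1 (volume Ω) := measure_le_rpow_mul hD hs0 hs1
        _ = max 1 (volume Ω) * (1 * volume D ^ (1 - s)) := by ring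
        _ ≤ max 1 (volume Ω) * T := mul_le_mul' le_rfl (mul_le_mul' hs le_rfl)
    calc ∫⁻ x in D, (A n + c * ∫⁻ z, G n z * rieszKernel d (z - x)) ^ 2
        ≤ ∫⁻ x in D, (2 * A n ^ 2 +
            2 * c ^ 2 * (∫⁻ z, G n z * rieszKernel d (z - x)) ^ 2) := by
          refine lintegral_mono fun x => (add_sq_le_two_mul _ _).trans_eq ?_
          ring
      _ = 2 * A n ^ 2 * volume D +
            2 * c ^ 2 * ∫⁻ x in D, (∫⁻ z, G n z * rieszKernel d (z - x)) ^ 2 := by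
          rw [lintegral_add_left measurable_const, setLIntegral_const,
            lintegral_const_mul _ ((hIm n).pow_const 2)]
      _ ≤ 2 * (V * volume B) * (max 1 (volume Ω) * T) +
            2 * c ^ 2 * (ENNReal.ofReal (2 * Real.pi * d) ^ 2 * ENNReal.ofReal (1 / s) *
              volume D ^ (1 - s) * (2 * W)) := by
          gcongr
          · exact hA n
          · refine (lintegral_sq_rieszPotential_le_ofReal (hGm n) D hd hs0 hs1).trans ?_
            gcongr
            exact hGsq n
      _ = (2 * volume B * max 1 (volume Ω)) * (T * V) +
            (4 * (c * ENNReal.ofReal (2 * Real.pi * d)) ^ 2) * (T * W) := by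
          simp only [T]
          ring
      _ ≤ (2 * volume B * max 1 (volume Ω)) * (T * (V + W)) +
            (4 * (c * ENNReal.ofReal (2 * Real.pi * d)) ^ 2) * (T * (V + W)) := by
          gcongr
          · exact le_self_add
          · exact le_add_self
      _ = _ := by ring

/-! ### The H¹ norm and the real-valued inequality -/

theorem ofReal_setIntegral_sq {f : Plane → ℝ} {S : Set Plane}
    (hf : MemLp f 2 (volume.restrict S)) :
    ENNReal.ofReal (∫ x in S, f x ^ 2) = ∫⁻ x in S, ‖f x‖ₑ ^ 2 := by
  rw [ofReal_integral_eq_lintegral_ofReal hf.integrable_sq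
    (Eventually.of_forall fun x => sq_nonneg _)]
  refine lintegral_congr fun x => ?_
  rw [← ofReal_norm, ← ENNReal.ofReal_pow (norm_nonneg _), Real.norm_eq_abs, sq_abs]

theorem isWeakPartial_weakPartial {Ω : Set Plane} {v : Plane → ℝ} (hv : MemH1 Ω v) (i : Fin 2) :
    IsWeakPartial Ω i v (weakPartial Ω i v) := by
  rw [weakPartial, dif_pos (hv.2 i)]
  exact (hv.2 i).choose_spec

theorem ofReal_h1Norm_sq {Ω : Set Plane} {v : Plane → ℝ} (hv : MemH1 Ω v) :
    ENNReal.ofReal (h1Norm Ω v ^ 2) = (∫⁻ x in Ω, ‖v x‖ₑ ^ 2) +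
      ∑ i, ∫⁻ x in Ω, ‖weakPartial Ω i v x‖ₑ ^ 2 := by
  have hw := fun i => (isWeakPartial_weakPartial hv i).1
  rw [h1Norm, Real.sq_sqrt (integral_nonneg fun x => by positivity),
    integral_add hv.1.integrable_sq (integrable_finsetSum _ fun i _ => (hw i).integrable_sq),
    integral_finsetSum _ fun i _ => (hw i).integrable_sq,
    ENNReal.ofReal_add (integral_nonneg fun x => sq_nonneg _)
      (Finset.sum_nonneg fun i _ => integral_nonneg fun x => sq_nonneg _),
    ENNReal.ofReal_sum_of_nonneg fun i _ => integral_nonneg fun x => sq_nonneg _,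
    ofReal_setIntegral_sq hv.1]
  simp only [fun i => ofReal_setIntegral_sq (hw i)]

theorem exists_lintegral_sq_le {Ω : Set Plane} (hΩo : IsOpen Ω) (hΩc : Convex ℝ Ω)
    (hΩb : Bornology.IsBounded Ω) (hne : Ω.Nonempty) :
    ∃ C : ℝ≥0∞, C ≠ ⊤ ∧ ∀ v, MemH1 Ω v → ∀ D, NullMeasurableSet D volume → D ⊆ Ω →
      ∀ s : ℝ, 0 < s → s < 1 → ∫⁻ x in D, ‖v x‖ₑ ^ 2 ≤
        C * (ENNReal.ofReal (1 / s) * volume D ^ (1 - s) *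
          ENNReal.ofReal (h1Norm Ω v ^ 2)) := by
  obtain ⟨p, hpΩ⟩ := hne
  obtain ⟨δ, hδ, hp⟩ := Metric.nhds_basis_closedBall.mem_iff.1 (hΩo.mem_nhds hpΩ)
  obtain ⟨r, hr, rfl⟩ : ∃ r, 0 < r ∧ δ = 2 * r := ⟨δ / 2, half_pos hδ, by ring⟩
  -- Adding 1 to the diameter gives both `1 ≤ d` and the strict bound on distances needed for open
  -- balls.
  have hd : 1 ≤ Metric.diam Ω + 1 := by linarith [Metric.diam_nonneg (s := Ω)]
  have hΩd : ∀ x ∈ Ω, ∀ y ∈ Ω, dist x y < Metric.diam Ω + 1 := fun x hx y hy =>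
    (Metric.dist_le_diam_of_mem hΩb hx hy).trans_lt (lt_add_one _)
  have hB0 : volume (Metric.ball p r) ^ 2 ≠ 0 := pow_ne_zero _ (Metric.measure_ball_pos _ _ hr).ne'
  have hBt : volume (Metric.ball p r) ^ 2 ≠ ⊤ := ENNReal.pow_ne_top measure_ball_lt_top.ne
  set C := 2 * volume (Metric.ball p r) * max 1 (volume Ω) +
    4 * (ENNReal.ofReal ((Metric.diam Ω + 1) ^ 2 / 2) *
      ENNReal.ofReal (2 * Real.pi * (Metric.diam Ω + 1))) ^ 2 with hC
  have hCt : C ≠ ⊤ := by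
    refine ENNReal.add_ne_top.2 ⟨?_, ?_⟩
    · refine ENNReal.mul_ne_top (ENNReal.mul_ne_top (by simp) measure_ball_lt_top.ne) ?_
      simp [hΩb.measure_lt_top.ne]
    · exact ENNReal.mul_ne_top (by simp)
        (ENNReal.pow_ne_top (ENNReal.mul_ne_top ofReal_ne_top ofReal_ne_top))
  refine ⟨C / volume (Metric.ball p r) ^ 2, ENNReal.div_ne_top hCt hB0,
    fun v hv D hDm hD s hs0 hs1 => ?_⟩
  have h := sq_measure_ball_mul_lintegral_le hΩo hΩc hd hΩd hr hp hv.1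
    (isWeakPartial_weakPartial hv) hDm hD hs0 hs1
  rw [← ofReal_h1Norm_sq hv, ← hC] at h
  rw [div_eq_mul_inv, mul_right_comm, ← div_eq_mul_inv,
    ENNReal.le_div_iff_mul_le (Or.inl hB0) (Or.inl hBt), mul_comm]
  exact h

end PlanarSobolev

theorem lemma2 (Ω : Set PlanarSobolev.Plane) (hΩ_open : IsOpen Ω)
    (hΩ_convex : Convex ℝ Ω) (hΩ_bounded : Bornology.IsBounded Ω) :
    ∃ C : ℝ, 0 < C ∧
      ∀ v : PlanarSobolev.Plane → ℝ, PlanarSobolev.MemH1 Ω v →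
      ∀ D : Set PlanarSobolev.Plane, NullMeasurableSet D volume → D ⊆ Ω →
      ∀ ε : ℝ, 0 < ε → ε < 1 →
        ∫ x in D, v x ^ 2 ≤
          C / ε * volume.real D ^ (1 - ε) * PlanarSobolev.h1Norm Ω v ^ 2 := by
  open PlanarSobolev in
  -- An empty `Ω` contains no ball to average over; both sides are then trivial.
  rcases Ω.eq_empty_or_nonempty with rfl | hne
  · refine ⟨1, one_pos, fun v _ D _ hD ε hε _ => ?_⟩
    rw [subset_empty_iff.1 hD]
    simp only [Measure.restrict_empty, integral_zero_measure]
    positivity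
  obtain ⟨C, hC, h⟩ := exists_lintegral_sq_le hΩ_open hΩ_convex hΩ_bounded hne
  -- The summand 1 guarantees a strictly positive constant.
  refine ⟨C.toReal + 1, by positivity, fun v hv D hDm hD ε hε0 hε1 => ?_⟩
  have hDt : volume D ≠ ⊤ := (hΩ_bounded.subset hD).measure_lt_top.ne
  rw [← ENNReal.ofReal_le_ofReal_iff (by positivity),
    ofReal_setIntegral_sq (hv.1.mono_measure (Measure.restrict_mono hD le_rfl))]
  refine (h v hv D hDm hD ε hε0 hε1).trans ?_
  have hDr : volume D ^ (1 - ε) = ENNReal.ofReal (volume.real D ^ (1 - ε)) := by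
    rw [← ENNReal.ofReal_rpow_of_nonneg measureReal_nonneg (by linarith), Measure.real,
      ENNReal.ofReal_toReal hDt]
  rw [hDr, ← ENNReal.ofReal_toReal hC, ← ENNReal.ofReal_mul (by positivity),
    ← ENNReal.ofReal_mul (by positivity), ← ENNReal.ofReal_mul (by positivity),
    ENNReal.ofReal_toReal hC]
  refine ENNReal.ofReal_le_ofReal ?_
  calc C.toReal * (1 / ε * volume.real D ^ (1 - ε) * h1Norm Ω v ^ 2)
      = C.toReal / ε * volume.real D ^ (1 - ε) * h1Norm Ω v ^ 2 := by ring
    _ ≤ _ := by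
      gcongr
      linarith
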